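/- Let $\mu,\nu,t\in\mathbb C$ with $\operatorname{Re}(\mu+\nu)>-1$ and $\mu+1\notin\{0,-1,-2,\dots\}$. On the unit circle $\mathbb T$ consider the weight $w(z)=(1+z)^{\mu}(1+1/z)^{\nu}e^{tz}$ (principal branches), with Fourier coefficients $w_k=\int_{\mathbb T}\frac{dz}{2\pi i z}\,w(z)z^{-k}$, Toeplitz determinants $I^{\epsilon}_n=\det[w_{-\epsilon+j-k}]_{0\le j,k\le n-1}$ ($\epsilon=0,\pm1$) and reflection coefficients $$r_n=(-1)^n\frac{I^1_n}{I^0_n},\qquad \bar r_n=(-1)^n\frac{I^{-1}_n}{I^0_n},$$ where $\bar r_n$ need not be the complex conjugate of $r_n$. The Painlevé V Hamiltonian is $tH=q(q-1)p(p+t)-(v_2-v_1+v_3-v_4)qp+(v_2-v_1)p+(v_1-v_3)tq$ with $v_1+v_2+v_3+v_4=0$; put $\alpha_0=1+v_4-v_2$, $\alpha_1=v_2-v_1$, $\alpha_2=v_1-v_3$, $\alpha_3=v_3-v_4$. The Hamiltonian variables $(q_n,p_n)_{n\ge0}$ are obtained from the seed $v_1-v_2=\mu$, $v_1-v_3=-\nu$,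 $v_3-v_4=0$, $q_0=1$, $p_0=t\frac{d}{dt}\log{}_1F_1(-\nu;\mu+1;-t)$ by iterating the Schlesinger transformation $(v_1,v_2,v_3,v_4)\mapsto(v_1-\tfrac14,v_2-\tfrac14,v_3-\tfrac14,v_4+\tfrac34)$, whose action on $(q,p)$ is $$q'=q+\frac{\alpha_0}{p+t},\qquad p'=p-\frac{\alpha_0+\alpha_1}{q'},\qquad q''=q'+\frac{\alpha_0+\alpha_1+\alpha_2}{p'},\qquad (q,p)\mapsto\Big(\frac{p'+t}{t},\,-t\,q''\Big).$$ Set $x_N=(p_N+t)q_N+\mu/2$ and $y_N=1/q_N$. Let $N\ge0$. Assume that $I^0_n\ne0$ for $0\le n\le N+1$, that $r_n\neq0$, $\bar r_n\ne0$ and $t\,r_{n+1}+(n+\nu)r_n\ne0$ for $0\le n\le N$, and that no denominator $p+t$, $q'$, $p'$ vanishes in the first $N$ Schlesinger steps. Then $q_N\ne0$, $\left(x_N-\frac{t}{y_N}-\frac{\mu}{2}\right)(1-y_N)-\nu\neq0$, and $$\Big(\frac1{y_N}-1\Big)\Big[x_N-\frac t{y_N}-\nu-\frac\mu2\Big]+N=(N+\nu)(1-r_N\bar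 r_N),$$ $$\Big[x_N-\frac t{y_N}-\nu-\frac\mu2\Big]\left(1+\frac{N+\nu}{\big(x_N-\frac{t}{y_N}-\frac\mu2\big)(1-y_N)-\nu}\right)-N=t\,\frac{r_{N+1}}{r_N}(1-r_N\bar r_N),$$ $$(1-y_N)\Big[x_N-\frac t{y_N}+\frac\mu2\Big]+N=-t\,\frac{\bar r_{N-1}}{\bar r_N}(1-r_N\bar r_N)\qquad(N\ge1).$$ Consequently $$y_N=\frac{\nu+t\,r_{N+1}\bar r_N}{\bar r_N\,[t\,r_{N+1}+(N+\nu)r_N]},\qquad x_N-\frac t{y_N}-\frac\mu2=-t\,r_{N+1}\bar r_N .$$ -/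

import Mathlib

noncomputable section

namespace PainleveV

/-- The weight `w(z) = (1 + z)^μ (1 + 1/z)^ν e^{tz}` on the unit circle (principal branches). -/
def weight (μ ν t z : ℂ) : ℂ :=
  (1 + z) ^ μ * (1 + z⁻¹) ^ ν * Complex.exp (t * z)

/-- The Fourier coefficient `w_k = ∫_{|z| = 1} w(z) z^{-k} dz / (2πiz)`. -/
def fourierCoef (w : ℂ → ℂ) (k : ℤ) : ℂ :=
  (2 * (Real.pi : ℂ) * Complex.I)⁻¹ * ∮ z in C(0, 1), w z * z ^ (-k) / z

/-- The Toeplitz determinant `I^ε_N[w] = det [w_{-ε+j-k}]`, `0 ≤ j, k ≤ N - 1`. -/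
def toeplitzDet (w : ℂ → ℂ) (ε : ℤ) (N : ℕ) : ℂ :=
  (Matrix.of fun j k : Fin N =>
    fourierCoef w (-ε + ((j : ℕ) : ℤ) - ((k : ℕ) : ℤ))).det

/-- The reflection coefficient `r_N = (-1)^N I^1_N[w] / I^0_N[w]`. -/
def refl (μ ν t : ℂ) (N : ℕ) : ℂ :=
  (-1) ^ N * (toeplitzDet (weight μ ν t) 1 N / toeplitzDet (weight μ ν t) 0 N)

/-- The conjugate reflection coefficient `r̄_N = (-1)^N I^{-1}_N[w] / I^0_N[w]`; for a complex
weight it is not the complex conjugate of `r_N`. -/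
def reflBar (μ ν t : ℂ) (N : ℕ) : ℂ :=
  (-1) ^ N * (toeplitzDet (weight μ ν t) (-1) N / toeplitzDet (weight μ ν t) 0 N)

/-- Kummer's confluent hypergeometric function `₁F₁(a; b; z)`. -/
def kummer (a b z : ℂ) : ℂ :=
  ∑' k : ℕ, (ascPochhammer ℂ k).eval a / (ascPochhammer ℂ k).eval b * z ^ k / (k.factorial : ℂ)

/-- Parameters and canonical variables of the Painlevé V Hamiltonian
`t H = q(q-1)p(p+t) - (v₂-v₁+v₃-v₄) q p + (v₂-v₁) p + (v₁-v₃) t q`, with the parameters recorded as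
`α₀ = 1 + v₄ - v₂`, `α₁ = v₂ - v₁`, `α₂ = v₁ - v₃`, `α₃ = v₃ - v₄` (so their sum is `1`). -/
@[ext] structure State where
  α₀ : ℂ
  α₁ : ℂ
  α₂ : ℂ
  α₃ : ℂ
  q : ℂ
  p : ℂ

namespace State

/-- The reflection in the root `α₀`. -/
def s₀ (t : ℂ) (S : State) : State where
  α₀ := -S.α₀
  α₁ := S.α₁ + S.α₀
  α₂ := S.α₂
  α₃ := S.α₃ + S.α₀
  q := S.q + S.α₀ / (S.p + t)
  p := S.p

/-- The reflection in the root `α₁`. -/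
def s₁ (S : State) : State where
  α₀ := S.α₀ + S.α₁
  α₁ := -S.α₁
  α₂ := S.α₂ + S.α₁
  α₃ := S.α₃
  q := S.q
  p := S.p - S.α₁ / S.q

/-- The reflection in the root `α₂`. -/
def s₂ (S : State) : State where
  α₀ := S.α₀
  α₁ := S.α₁ + S.α₂
  α₂ := -S.α₂
  α₃ := S.α₃ + S.α₂
  q := S.q + S.α₂ / S.p
  p := S.p

/-- The rotation of the Dynkin diagram of type `A₃⁽¹⁾`. -/
def rot (t : ℂ) (S : State) : State where
  α₀ := S.α₃
  α₁ := S.α₀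
  α₂ := S.α₁
  α₃ := S.α₂
  q := (S.p + t) / t
  p := -t * S.q

/-- The Schlesinger transformation which acts on the parameters by
`(v₁, v₂, v₃, v₄) ↦ (v₁ - 1/4, v₂ - 1/4, v₃ - 1/4, v₄ + 3/4)`, that is
`(α₀, α₁, α₂, α₃) ↦ (α₀ + 1, α₁, α₂, α₃ - 1)`. -/
def schlesinger (t : ℂ) (S : State) : State :=
  ((S.s₀ t).s₁.s₂).rot t

/-- The three reflections which make up the Schlesinger transformation have no vanishing
denominator at `S`. -/
def Regular (t : ℂ) (S : State) : Prop :=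
  S.p + t ≠ 0 ∧ (S.s₀ t).q ≠ 0 ∧ (S.s₀ t).s₁.p ≠ 0

end State

/-- The seed: `v₁ - v₂ = μ`, `v₁ - v₃ = -ν`, `v₃ - v₄ = 0`, `q₀ = 1` and
`p₀ = t (d/dt) log ₁F₁(-ν; μ+1; -t)`. -/
def seed (μ ν t : ℂ) : State where
  α₀ := 1 + μ + ν
  α₁ := -μ
  α₂ := -ν
  α₃ := 0
  q := 1
  p := t * logDeriv (fun s => kummer (-ν) (μ + 1) (-s)) t

/-- The `N`-th member of the sequence generated from the seed. -/
def state (μ ν t : ℂ) (N : ℕ) : State :=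
  (State.schlesinger t)^[N] (seed μ ν t)

/-- `q_N`. -/
def qVar (μ ν t : ℂ) (N : ℕ) : ℂ := (state μ ν t N).q

/-- `p_N`. -/
def pVar (μ ν t : ℂ) (N : ℕ) : ℂ := (state μ ν t N).p

/-- `x_N = (p_N + t) q_N + μ/2`. -/
def xVar (μ ν t : ℂ) (N : ℕ) : ℂ := (pVar μ ν t N + t) * qVar μ ν t N + μ / 2

/-- `y_N = 1/q_N`. -/
def yVar (μ ν t : ℂ) (N : ℕ) : ℂ := 1 / qVar μ ν t N

end PainleveV

end

/-!
Let `c k` be the Fourier coefficients of the weight `w`. The numbers `r n`, `r̄ n` are the reflection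
coefficients of the Szegő recursion `a (n+1) = z a n + r (n+1) b n`, `b (n+1) = b n + r̄ (n+1) z a n`,
where `a n` is monic of degree `n`, orthogonal to `1, …, z^(n-1)`, and `b n` is the reversed
polynomial of the dual family: `a n` has constant term `r n` and `b n` has leading coefficient `r̄ n`
(`IsSzegoPair.coeff_zero`, `IsSzegoPair.coeff_self`).

The weight is semiclassical, `(1 + z) z w' = (t z² + (μ + t) z - ν) w`, so integration by parts
expresses `z (1 + z) (a n)'` and `(1 + z) (b n)'` through `a n` and `b n` with coefficients that are
polynomials of degree at most one in `z` (`IsSzegoPair.derivative_a`, `IsSzegoPair.derivative_b`).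
At the zero `z = -1` of `1 + z` the left sides vanish. With `A n`, `B n` the values of `a n`, `b n`
at `-1`, what remains is (`exists_values_at_neg_one`)

* `(ν + t r (n+1) r̄ n) A n = (t r (n+1) + (n + ν) r n) B n`,
* `(μ - t r (n+1) r̄ n) B n = -((n + 1 + ν) r̄ (n+1) + t r̄ n) A n`.

The Hamiltonian variables are `q n = r̄ n A n / B n` and `p n = -t r (n+1) B n / A n`. The case `n = 0`
is the identity `w₀(t) = w₀(0) ₁F₁(-ν; μ+1; -t)` together with `∂w₀/∂t = w₋₁` (`seed_p`). The induction
step (`state_eq`) is a computation from the recursion for `A`, `B` and the two relations: the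
denominators of the Schlesinger transformation are, up to known factors,
`p + t = -t A (n+1) / A n` and `q' = -(n + 1 + ν) A n B (n+1) / (t B n A (n+1))`. Hence regularity
of the steps makes `A (n+1)`, `B (n+1)` and `n + 1 + ν` nonzero. The asserted
formulas follow from those for `q N` and `p N` by algebra.
-/

namespace PainleveV

open Polynomial MeasureTheory

/-! ### Toeplitz determinants and Szegő recursion -/

/-- The determinant `det [c_{-ε+j-k}]` of a Toeplitz matrix with symbol coefficients `c`. -/
def toepDet (c : ℤ → ℂ) (ε : ℤ) (n : ℕ) : ℂ :=
  (Matrix.of fun j k : Fin n => c (-ε + ((j : ℕ) : ℤ) - ((k : ℕ) : ℤ))).det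

/-- The functional `f ↦ ∑ⱼ fⱼ c_{k-j}`, which is `f ↦ ∫ f(z) z^{-k} w(z) dz / (2πiz)` when `c` is
the sequence of Fourier coefficients of `w`. -/
def moment (c : ℤ → ℂ) (k : ℤ) : ℂ[X] →ₗ[ℂ] ℂ :=
  Polynomial.lsum fun j => LinearMap.mulRight ℂ (c (k - j))

theorem moment_monomial (c : ℤ → ℂ) (k : ℤ) (j : ℕ) (x : ℂ) :
    moment c k (monomial j x) = x * c (k - j) := by
  simp [moment, Polynomial.lsum_apply]

theorem moment_one (c : ℤ → ℂ) (k : ℤ) : moment c k 1 = c k := by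
  simpa using moment_monomial c k 0 1

theorem moment_C_mul (c : ℤ → ℂ) (k : ℤ) (x : ℂ) (f : ℂ[X]) :
    moment c k (C x * f) = x * moment c k f := by
  rw [← smul_eq_C_mul, map_smul, smul_eq_mul]

theorem moment_X_mul (c : ℤ → ℂ) (k : ℤ) (f : ℂ[X]) :
    moment c k (X * f) = moment c (k - 1) f := by
  induction f using Polynomial.induction_on' with
  | add p q hp hq => rw [mul_add, map_add, map_add, hp, hq]
  | monomial j x =>
    rw [X_mul_monomial, moment_monomial, moment_monomial]
    congr 2
    push_cast
    ring

theorem moment_eq_sum (c : ℤ → ℂ) (k : ℤ) {f : ℂ[X]} {n : ℕ} (hf : ∀ j, n ≤ j → f.coeff j = 0) :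
    moment c k f = ∑ j : Fin n, c (k - (j : ℕ)) * f.coeff j := by
  rw [moment, Polynomial.lsum_apply, Polynomial.sum_def,
    Fin.sum_univ_eq_sum_range (fun j => c (k - (j : ℕ)) * f.coeff j) n]
  rw [Finset.sum_subset (s₂ := Finset.range n)]
  · exact Finset.sum_congr rfl fun j _ => by simp [mul_comm]
  · intro j hj
    rw [Finset.mem_range]
    by_contra hlt
    exact (mem_support_iff.mp hj) (hf j (not_lt.mp hlt))
  · intro j _ hj
    simp [notMem_support_iff.mp hj]

/-- A relation `W x = 0` between the columns of an `n × (n + 1)` matrix determines the ratio of the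
two outer maximal minors. -/
theorem coeff_last_mul_det {n : ℕ} (W : Matrix (Fin n) (Fin (n + 1)) ℂ) (x : Fin (n + 1) → ℂ)
    (h : W.mulVec x = 0) :
    x (Fin.last n) * (W.submatrix id Fin.succ).det =
      (-1) ^ n * x 0 * (W.submatrix id Fin.castSucc).det := by
  -- Cramer's rule for `W` with the first unit row vector put on top.
  let M : Matrix (Fin (n + 1)) (Fin (n + 1)) ℂ :=
    Matrix.of (Matrix.vecCons (Pi.single 0 1) fun i => W i)
  have hM0 : M.mulVec x 0 = x 0 := by
    simp [M, Matrix.mulVec, dotProduct, Pi.single_apply]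
  have hMs : ∀ i : Fin n, M.mulVec x i.succ = 0 := fun i => by
    simpa [M, Matrix.mulVec, dotProduct] using congrFun h i
  have hsub : ∀ j : Fin (n + 1), M.submatrix (Fin.succAbove 0) j.succAbove =
      W.submatrix id j.succAbove := fun j => by
    ext a b
    simp [M]
  have hM : ∀ j, M 0 j = (Pi.single 0 1 : Fin (n + 1) → ℂ) j := fun _ => rfl
  have hdet : M.det = (W.submatrix id Fin.succ).det := by
    rw [Matrix.det_succ_row_zero, Finset.sum_eq_single 0]
    · rw [hM, ← Fin.succAbove_zero, hsub 0]
      simp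
    · intro j _ hj
      rw [hM, Pi.single_eq_of_ne hj]
      ring
    · simp
  have key : M.adjugate.mulVec (M.mulVec x) = M.det • x := by
    rw [Matrix.mulVec_mulVec, Matrix.adjugate_mul, Matrix.smul_mulVec, Matrix.one_mulVec]
  have key' := congrFun key (Fin.last n)
  rw [Matrix.mulVec, dotProduct, Fin.sum_univ_succ, hM0] at key'
  simp only [hMs, mul_zero, Finset.sum_const_zero, add_zero, Pi.smul_apply, smul_eq_mul] at key'
  rw [Matrix.adjugate_fin_succ_eq_det_submatrix, hsub, hdet] at key'
  simp only [Fin.succAbove_last, Fin.val_last, Fin.val_zero, zero_add] at key'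
  linear_combination -key'

theorem eq_zero_of_moment_eq_zero (c : ℤ → ℂ) {n : ℕ} (hn : toepDet c 0 n ≠ 0) {f : ℂ[X]}
    (hf : ∀ j, n ≤ j → f.coeff j = 0) (h : ∀ k : ℕ, k < n → moment c k f = 0) : f = 0 := by
  have h0 := Matrix.eq_zero_of_mulVec_eq_zero (v := fun j : Fin n => f.coeff j) hn (by
    ext k
    have := h k k.2
    rw [moment_eq_sum c k hf] at this
    simpa [Matrix.mulVec, dotProduct] using this)
  ext j
  rcases lt_or_ge j n with hj | hj
  · exact congrFun h0 ⟨j, hj⟩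
  · exact hf j hj

theorem toepDet_one (c : ℤ → ℂ) (ε : ℤ) : toepDet c ε 1 = c (-ε) := by
  unfold toepDet
  simp

theorem toepDet_zero (c : ℤ → ℂ) (ε : ℤ) : toepDet c ε 0 = 1 := by
  simp [toepDet]

/-- A polynomial of degree at most `n` that is orthogonal to `1, …, z^{n-1}` has the ratio of its
outer coefficients given by Toeplitz determinants. -/
theorem coeff_zero_mul_toepDet (c : ℤ → ℂ) {n : ℕ} {f : ℂ[X]}
    (hf : ∀ j, n < j → f.coeff j = 0) (h : ∀ k : ℕ, k < n → moment c k f = 0) :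
    f.coeff n * toepDet c 1 n = (-1) ^ n * f.coeff 0 * toepDet c 0 n := by
  have := coeff_last_mul_det
    (Matrix.of fun (j : Fin n) (k : Fin (n + 1)) => c ((j : ℕ) - (k : ℕ))) (fun j => f.coeff j) (by
      ext k
      have := h k k.2
      rw [moment_eq_sum c k hf] at this
      simpa [Matrix.mulVec, dotProduct] using this)
  have e₁ : toepDet c 1 n = ((Matrix.of fun (j : Fin n) (k : Fin (n + 1)) =>
      c ((j : ℕ) - (k : ℕ))).submatrix id Fin.succ).det := by
    unfold toepDet
    congr 1
    ext j k
    simp only [Matrix.of_apply, Matrix.submatrix_apply, Fin.val_succ, id]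
    congr 1
    push_cast
    ring
  have e₀ : toepDet c 0 n = ((Matrix.of fun (j : Fin n) (k : Fin (n + 1)) =>
      c ((j : ℕ) - (k : ℕ))).submatrix id Fin.castSucc).det := by
    unfold toepDet
    congr 1
    ext j k
    simp
  rw [e₁, e₀]
  simpa only [Fin.val_last, Fin.val_zero] using this

/-- The counterpart of `coeff_zero_mul_toepDet` for polynomials orthogonal to `z, …, z^n`. -/
theorem coeff_mul_toepDet (c : ℤ → ℂ) {n : ℕ} {f : ℂ[X]}
    (hf : ∀ j, n < j → f.coeff j = 0) (h : ∀ k : ℕ, 1 ≤ k → k ≤ n → moment c k f = 0) :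
    f.coeff n * toepDet c 0 n = (-1) ^ n * f.coeff 0 * toepDet c (-1) n := by
  have := coeff_last_mul_det
    (Matrix.of fun (j : Fin n) (k : Fin (n + 1)) => c ((j : ℕ) + 1 - (k : ℕ)))
    (fun j => f.coeff j) (by
      ext k
      have := h (k + 1) (by omega) (by omega)
      rw [moment_eq_sum c _ hf] at this
      simpa [Matrix.mulVec, dotProduct] using this)
  have e₀ : toepDet c 0 n = ((Matrix.of fun (j : Fin n) (k : Fin (n + 1)) =>
      c ((j : ℕ) + 1 - (k : ℕ))).submatrix id Fin.succ).det := by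
    unfold toepDet
    congr 1
    ext j k
    simp only [Matrix.of_apply, Matrix.submatrix_apply, Fin.val_succ, id]
    congr 1
    push_cast
    ring
  have e₁ : toepDet c (-1) n = ((Matrix.of fun (j : Fin n) (k : Fin (n + 1)) =>
      c ((j : ℕ) + 1 - (k : ℕ))).submatrix id Fin.castSucc).det := by
    unfold toepDet
    congr 1
    ext j k
    simp only [Matrix.of_apply, Matrix.submatrix_apply, Fin.val_castSucc, id]
    congr 1
    ring
  rw [e₁, e₀]
  simpa only [Fin.val_last, Fin.val_zero] using this

/-- `a` is the monic polynomial of degree `n` with `∫ a(z) z^{-k} w(z) dz/z = 0` for `0 ≤ k < n`, and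
`b` is the reversed partner: `b(0) = 1`, `deg b ≤ n` and `∫ b(z) z^{-k} w(z) dz/z = 0` for
`1 ≤ k ≤ n`.  They have the common norm `h`. -/
structure IsSzegoPair (c : ℤ → ℂ) (n : ℕ) (h : ℂ) (a b : ℂ[X]) : Prop where
  a_coeff_gt : ∀ j, n < j → a.coeff j = 0
  a_coeff : a.coeff n = 1
  b_coeff_gt : ∀ j, n < j → b.coeff j = 0
  b_coeff : b.coeff 0 = 1
  a_orth : ∀ k : ℕ, k < n → moment c k a = 0
  a_norm : moment c n a = h
  b_orth : ∀ k : ℕ, 1 ≤ k → k ≤ n → moment c k b = 0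
  b_norm : moment c 0 b = h

namespace IsSzegoPair

variable {c : ℤ → ℂ} {n : ℕ} {h : ℂ} {a b : ℂ[X]}

theorem coeff_zero (P : IsSzegoPair c n h a b) (hn : toepDet c 0 n ≠ 0) :
    a.coeff 0 = (-1) ^ n * (toepDet c 1 n / toepDet c 0 n) := by
  have := coeff_zero_mul_toepDet c P.a_coeff_gt P.a_orth
  have h1 : ((-1 : ℂ) ^ n) * (-1) ^ n = 1 := by rw [← mul_pow]; simp
  rw [P.a_coeff] at this
  field_simp
  linear_combination (-(a.coeff 0 * toepDet c 0 n)) * h1 - (-1) ^ n * this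

theorem coeff_self (P : IsSzegoPair c n h a b) (hn : toepDet c 0 n ≠ 0) :
    b.coeff n = (-1) ^ n * (toepDet c (-1) n / toepDet c 0 n) := by
  have := coeff_mul_toepDet c P.b_coeff_gt P.b_orth
  rw [P.b_coeff] at this
  field_simp
  linear_combination this

theorem norm_ne_zero (P : IsSzegoPair c n h a b) (hn : toepDet c 0 (n + 1) ≠ 0) : h ≠ 0 := by
  rintro rfl
  have : a = 0 := eq_zero_of_moment_eq_zero c hn (fun j hj => P.a_coeff_gt j hj) fun k hk => by
    rcases Nat.lt_succ_iff_lt_or_eq.mp hk with hk | rfl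
    · exact P.a_orth k hk
    · exact P.a_norm
  have h1 := P.a_coeff
  simp [this] at h1

theorem step (P : IsSzegoPair c n h a b) {ρ σ : ℂ} (hρ : moment c (-1) a = -ρ * h)
    (hσ : moment c (n + 1) b = -σ * h) :
    IsSzegoPair c (n + 1) (h * (1 - ρ * σ)) (X * a + C ρ * b) (b + C σ * (X * a)) where
  a_coeff_gt j hj := by
    obtain ⟨j, rfl⟩ := Nat.exists_eq_succ_of_ne_zero (by omega : j ≠ 0)
    simp [P.a_coeff_gt j (by omega), P.b_coeff_gt (j + 1) (by omega)]
  a_coeff := by simp [P.a_coeff, P.b_coeff_gt (n + 1) (by omega)]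
  b_coeff_gt j hj := by
    obtain ⟨j, rfl⟩ := Nat.exists_eq_succ_of_ne_zero (by omega : j ≠ 0)
    simp [P.a_coeff_gt j (by omega), P.b_coeff_gt (j + 1) (by omega)]
  b_coeff := by simp [P.b_coeff]
  a_orth k hk := by
    rw [map_add, moment_C_mul, moment_X_mul]
    rcases k with - | k
    · have : moment c ((0 : ℕ) : ℤ) b = h := P.b_norm
      rw [this, Nat.cast_zero, zero_sub, hρ]
      ring
    · rw [P.b_orth (k + 1) (by omega) (by omega)]
      have := P.a_orth k (by omega)
      push_cast
      rw [add_sub_cancel_right, this]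
      ring
  a_norm := by
    rw [map_add, moment_C_mul, moment_X_mul]
    push_cast
    rw [add_sub_cancel_right, P.a_norm, hσ]
    ring
  b_orth k hk hkn := by
    rw [map_add, moment_C_mul, moment_X_mul]
    obtain ⟨k, rfl⟩ := Nat.exists_eq_succ_of_ne_zero (by omega : k ≠ 0)
    push_cast
    rw [add_sub_cancel_right]
    rcases Nat.lt_or_ge k n with hk' | hk'
    · have := P.b_orth (k + 1) (by omega) (by omega)
      push_cast at this
      rw [P.a_orth k hk', this]
      ring
    · obtain rfl : k = n := by omega
      rw [P.a_norm, hσ]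
      ring
  b_norm := by
    rw [map_add, moment_C_mul, moment_X_mul, P.b_norm, zero_sub, hρ]
    ring

end IsSzegoPair

theorem isSzegoPair_zero (c : ℤ → ℂ) : IsSzegoPair c 0 (c 0) 1 1 where
  a_coeff_gt j hj := by simp [coeff_one, hj.ne']
  a_coeff := by simp
  b_coeff_gt j hj := by simp [coeff_one, hj.ne']
  b_coeff := by simp
  a_orth k hk := by omega
  a_norm := by simp [moment_one]
  b_orth k hk hk' := by omega
  b_norm := by simp [moment_one]

/-- The Szegő recursion with reflection coefficients `r`, `s`: the pair `(a_n, b_n)` of polynomials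
with `a_{n+1} = z a_n + r_{n+1} b_n` and `b_{n+1} = b_n + s_{n+1} z a_n`. -/
noncomputable def szegoPoly (r s : ℕ → ℂ) : ℕ → ℂ[X] × ℂ[X]
  | 0 => (1, 1)
  | n + 1 => (X * (szegoPoly r s n).1 + C (r (n + 1)) * (szegoPoly r s n).2,
      (szegoPoly r s n).2 + C (s (n + 1)) * (X * (szegoPoly r s n).1))

section Reflection

variable {c : ℤ → ℂ} {r s : ℕ → ℂ}
  (hr : ∀ n, r n = (-1) ^ n * (toepDet c 1 n / toepDet c 0 n))
  (hs : ∀ n, s n = (-1) ^ n * (toepDet c (-1) n / toepDet c 0 n))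

include hr hs in
/-- The coefficients of the recursion step, which orthogonality forces, are the ratios of Toeplitz
determinants because they are the outer coefficients of the next pair. -/
theorem moment_eq_of_isSzegoPair {n : ℕ} {h : ℂ} {a b : ℂ[X]} (P : IsSzegoPair c n h a b)
    (hn : toepDet c 0 (n + 1) ≠ 0) :
    moment c (-1) a = -r (n + 1) * h ∧ moment c (n + 1) b = -s (n + 1) * h := by
  have hh := P.norm_ne_zero hn
  have Q := P.step (ρ := -moment c (-1) a / h) (σ := -moment c (n + 1) b / h)
    (by field_simp) (by field_simp)
  have h₁ := Q.coeff_zero hn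
  have h₂ := Q.coeff_self hn
  rw [← hr] at h₁
  rw [← hs] at h₂
  simp [P.b_coeff, P.a_coeff, P.b_coeff_gt] at h₁ h₂
  rw [← h₁, ← h₂]
  constructor <;> field_simp

include hr hs in
/-- As long as the Toeplitz determinants do not vanish, the Szegő recursion produces the
biorthogonal polynomials. -/
theorem exists_isSzegoPair {N : ℕ} (hN : ∀ n ≤ N, toepDet c 0 n ≠ 0) :
    ∀ n ≤ N, ∃ h, IsSzegoPair c n h (szegoPoly r s n).1 (szegoPoly r s n).2 := by
  intro n
  induction n with
  | zero => exact fun _ => ⟨_, isSzegoPair_zero c⟩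
  | succ n ih =>
    intro hn
    obtain ⟨h, P⟩ := ih (by omega)
    obtain ⟨h₁, h₂⟩ := moment_eq_of_isSzegoPair hr hs P (hN _ hn)
    exact ⟨_, P.step h₁ h₂⟩

include hr hs in
theorem one_sub_mul_ne_zero {N : ℕ} (hN : ∀ n ≤ N + 1, toepDet c 0 n ≠ 0) {n : ℕ} (hn : n < N) :
    1 - r (n + 1) * s (n + 1) ≠ 0 := by
  obtain ⟨h, P⟩ := exists_isSzegoPair hr hs hN n (by omega)
  obtain ⟨h₁, h₂⟩ := moment_eq_of_isSzegoPair hr hs P (hN _ (by omega))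
  exact right_ne_zero_of_mul ((P.step h₁ h₂).norm_ne_zero (hN _ (by omega)))

end Reflection

/-! ### The differential relations of the biorthogonal polynomials -/

section Pearson

variable {c : ℤ → ℂ} {μ ν t : ℂ}
  (hc : ∀ k : ℤ, (k + ν) * c k = (μ + t - k + 1) * c (k - 1) + t * c (k - 2))

include hc in
/-- Integration by parts against the weight: the recurrence `hc` is the Pearson equation in terms
of Fourier coefficients. -/
theorem moment_derivative (k : ℤ) (f : ℂ[X]) :
    moment c k (X * derivative f) + moment c (k - 1) (X * derivative f) =
      -(t * moment c (k - 2) f + (μ + t + 1 - k) * moment c (k - 1) f - (k + ν) * moment c k f) := by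
  induction f using Polynomial.induction_on' with
  | add p q hp hq =>
    simp only [mul_add, map_add]
    linear_combination hp + hq
  | monomial j x =>
    have hX : X * derivative (monomial j x) = monomial j (x * j) := by
      rcases j with - | j
      · simp
      · rw [derivative_monomial, X_mul_monomial, Nat.add_sub_cancel]
    rw [hX]
    simp only [moment_monomial]
    have := hc (k - j)
    rw [show k - j - 1 = k - 1 - j by ring, show k - j - 2 = k - 2 - j by ring] at this
    push_cast at this
    linear_combination (-x) * this

theorem coeff_X_mul_derivative (f : ℂ[X]) (j : ℕ) :
    (X * derivative f).coeff j = j * f.coeff j := by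
  rcases j with - | j
  · simp
  · rw [coeff_X_mul, coeff_derivative]
    push_cast
    ring

include hc in
/-- Both sides vanish at `0`, agree in degree `n + 1`, and have the same moments of orders
`1, …, n`; nondegeneracy of the Toeplitz matrix of size `n` then gives equality. -/
theorem IsSzegoPair.derivative_a {n : ℕ} {h : ℂ} {a b : ℂ[X]} (P : IsSzegoPair c n h a b)
    (hn : toepDet c 0 n ≠ 0) {ρ : ℂ} (hρ : moment c (-1) a = -ρ * h) :
    X * derivative a + X * (X * derivative a) =
      C (n - t * ρ * b.coeff n) * (X * a) + C (n + ν) * a + C (t * ρ) * (X * b)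
        - C ((n + ν) * a.coeff 0) * b := by
  set F := X * derivative a + X * (X * derivative a) -
    (C (n - t * ρ * b.coeff n) * (X * a) + C (n + ν) * a + C (t * ρ) * (X * b)
        - C ((n + ν) * a.coeff 0) * b) with hF
  have hF0 : F.coeff 0 = 0 := by
    simp [hF, P.b_coeff]
  have hFX : F = X * F.divX := by
    have := F.X_mul_divX_add
    rw [hF0] at this
    simpa using this.symm
  have hdiv : F.divX = 0 := by
    refine eq_zero_of_moment_eq_zero c hn (fun j hj => ?_) fun k hk => ?_
    · rw [coeff_divX, hF]
      simp only [coeff_sub, coeff_add, coeff_X_mul, coeff_C_mul, coeff_X_mul_derivative,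
        coeff_derivative]
      rw [P.a_coeff_gt (j + 1) (by omega), P.b_coeff_gt (j + 1) (by omega)]
      rcases hj.eq_or_lt with rfl | hj
      · rw [P.a_coeff]
        ring
      · rw [P.a_coeff_gt j hj, P.b_coeff_gt j hj]
        ring
    · have h0 : moment c k F.divX = moment c (k + 1) F := by
        conv_rhs => rw [hFX, moment_X_mul, add_sub_cancel_right]
      have hd := moment_derivative hc (k + 1) a
      rw [h0, hF]
      simp only [LinearMap.map_sub, LinearMap.map_add, moment_C_mul]
      rw [moment_X_mul c _ (X * derivative a), hd, moment_X_mul, moment_X_mul]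
      rw [add_sub_cancel_right, P.a_orth k hk, show (k : ℤ) + 1 - 2 = k - 1 by ring]
      have hb1 : moment c (k + 1) b = 0 := by
        simpa using P.b_orth (k + 1) (by omega) (by omega)
      have ha1 : ((k : ℂ) + 1 + ν) * moment c (k + 1) a = (n + ν) * moment c (k + 1) a := by
        rcases Nat.lt_or_ge (k + 1) n with hk' | hk'
        · have := P.a_orth (k + 1) hk'
          push_cast at this
          rw [this]
          ring
        · obtain rfl : n = k + 1 := by omega
          push_cast
          ring
      have hb0 : t * moment c (k - 1) a = -(t * ρ) * moment c k b := by
        rcases k with - | k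
        · have : moment c ((0 : ℕ) : ℤ) b = h := P.b_norm
          rw [this, Nat.cast_zero, zero_sub, hρ]
          ring
        · have h₁ := P.b_orth (k + 1) (by omega) (by omega)
          have h₂ := P.a_orth k (by omega)
          rw [h₁]
          push_cast
          rw [add_sub_cancel_right, h₂]
          ring
      rw [hb1]
      push_cast
      linear_combination ha1 - hb0
  rw [← sub_eq_zero, ← hF, hFX, hdiv, mul_zero]

include hc in
/-- Both sides have degree at most `n` and the same moments of orders `0, …, n`. -/
theorem IsSzegoPair.derivative_b {n : ℕ} {h : ℂ} {a b : ℂ[X]} (P : IsSzegoPair c n h a b)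
    (hn : toepDet c 0 (n + 1) ≠ 0) {ρ σ : ℂ} (hρ : moment c (-1) a = -ρ * h)
    (hσ : moment c (n + 1) b = -σ * h) :
    derivative b + X * derivative b =
      C (t * ρ * b.coeff n - μ - t) * b - C ((n + 1 + ν) * σ) * a
        - C t * (X * (b - C (b.coeff n) * a)) := by
  rw [← sub_eq_zero]
  refine eq_zero_of_moment_eq_zero c hn (fun j hj => ?_) fun k hk => ?_
  · simp only [coeff_sub, coeff_add, coeff_C_mul, coeff_X_mul_derivative, coeff_derivative]
    obtain ⟨j, rfl⟩ := Nat.exists_eq_succ_of_ne_zero (by omega : j ≠ 0)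
    simp only [coeff_X_mul, coeff_sub, coeff_C_mul]
    rw [P.a_coeff_gt _ hj, P.b_coeff_gt _ hj, P.b_coeff_gt _ (by omega)]
    rcases (Nat.lt_succ_iff.mp hj).eq_or_lt with rfl | hj
    · rw [P.a_coeff]
      ring
    · rw [P.a_coeff_gt j hj, P.b_coeff_gt j hj]
      ring
  · have hd := moment_derivative hc (k + 1) b
    rw [moment_X_mul, moment_X_mul] at hd
    rw [add_sub_cancel_right] at hd
    simp only [LinearMap.map_sub, LinearMap.map_add, moment_C_mul]
    rw [moment_X_mul, moment_X_mul, hd]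
    simp only [LinearMap.map_sub, moment_C_mul]
    rw [show (k : ℤ) + 1 - 2 = k - 1 by ring]
    have h₁ : ((k : ℂ) + 1 + ν) * moment c (k + 1) b = -(n + 1 + ν) * σ * moment c k a := by
      rcases Nat.lt_or_ge k n with hk' | hk'
      · rw [P.a_orth k hk']
        have := P.b_orth (k + 1) (by omega) (by omega)
        push_cast at this
        rw [this]
        ring
      · -- `k = n` is the only order at which the moment of `a` survives.
        obtain rfl : n = k := by omega
        rw [P.a_norm, hσ]
        ring
    have h₂ : (k : ℂ) * moment c k b = 0 := by
      rcases k with - | k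
      · simp
      · rw [P.b_orth (k + 1) (by omega) (by omega), mul_zero]
    have h₃ : moment c (k - 1) a = -ρ * moment c k b := by
      rcases k with - | k
      · have : moment c ((0 : ℕ) : ℤ) b = h := P.b_norm
        rw [this, Nat.cast_zero, zero_sub, hρ]
      · rw [P.b_orth (k + 1) (by omega) (by omega)]
        push_cast
        rw [add_sub_cancel_right, P.a_orth k (by omega)]
        ring
    push_cast
    linear_combination h₁ + h₂ - t * b.coeff n * h₃

end Pearson

/-! ### Fourier coefficients of the weight -/

theorem norm_cpow_le_mul_exp (z w : ℂ) : ‖z ^ w‖ ≤ ‖z‖ ^ w.re * Real.exp (Real.pi * |w.im|) := by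
  refine (Complex.norm_cpow_le z w).trans ?_
  rw [div_eq_mul_inv, ← Real.exp_neg]
  gcongr
  refine (neg_le_abs _).trans ?_
  rw [abs_mul]
  gcongr
  exact Complex.abs_arg_le_pi z

theorem norm_one_add_exp (θ : ℝ) :
    ‖1 + Complex.exp (θ * Complex.I)‖ = 2 * |Real.sin ((θ - Real.pi) / 2)| := by
  have h := Complex.norm_exp_I_mul_ofReal_sub_one (θ - Real.pi)
  have e : Complex.exp (Complex.I * ((θ - Real.pi : ℝ) : ℂ)) - 1 =
      -(1 + Complex.exp (θ * Complex.I)) := by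
    push_cast
    rw [mul_sub, Complex.exp_sub, mul_comm Complex.I (Real.pi : ℂ), Complex.exp_pi_mul_I,
      mul_comm Complex.I]
    ring
  rw [e, norm_neg] at h
  rw [h, norm_mul]
  simp

theorem le_norm_one_add_exp {θ : ℝ} (h₀ : 0 ≤ θ) (h₁ : θ ≤ 2 * Real.pi) :
    2 / Real.pi * |θ - Real.pi| ≤ ‖1 + Complex.exp (θ * Complex.I)‖ := by
  rw [norm_one_add_exp]
  have := Real.mul_abs_le_abs_sin (x := (θ - Real.pi) / 2) (by
    rw [abs_le]
    constructor <;> linarith)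
  rw [abs_div, abs_two] at this
  linarith

theorem one_add_exp_ne_zero {θ : ℝ} (h₀ : 0 ≤ θ) (h₁ : θ ≤ 2 * Real.pi) (h : θ ≠ Real.pi) :
    1 + Complex.exp (θ * Complex.I) ≠ 0 := by
  have := le_norm_one_add_exp h₀ h₁
  have h2 : 0 < 2 / Real.pi * |θ - Real.pi| := by
    have := abs_pos.mpr (sub_ne_zero.mpr h)
    positivity
  exact norm_pos_iff.mp (h2.trans_le this)

theorem norm_weight_exp_le (μ ν t : ℂ) {θ : ℝ} (h : 1 + Complex.exp (θ * Complex.I) ≠ 0) :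
    ‖weight μ ν t (Complex.exp (θ * Complex.I))‖ ≤
      Real.exp (Real.pi * |μ.im|) * Real.exp (Real.pi * |ν.im|) * Real.exp ‖t‖ *
        ‖1 + Complex.exp (θ * Complex.I)‖ ^ (μ + ν).re := by
  set z := Complex.exp (θ * Complex.I) with hz
  have hz1 : ‖z‖ = 1 := Complex.norm_exp_ofReal_mul_I θ
  have hz0 : z ≠ 0 := Complex.exp_ne_zero _
  have hinv : ‖1 + z⁻¹‖ = ‖1 + z‖ := by
    have : 1 + z⁻¹ = z⁻¹ * (1 + z) := by field_simp; ring
    rw [this, norm_mul, norm_inv, hz1]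
    simp
  have h₁ := norm_cpow_le_mul_exp (1 + z) μ
  have h₂ := norm_cpow_le_mul_exp (1 + z⁻¹) ν
  rw [hinv] at h₂
  have h₃ : ‖Complex.exp (t * z)‖ ≤ Real.exp ‖t‖ := by
    refine (Complex.norm_exp_le_exp_norm _).trans ?_
    rw [norm_mul, hz1, mul_one]
  rw [weight, norm_mul, norm_mul, Complex.add_re, Real.rpow_add (norm_pos_iff.mpr h)]
  calc _ ≤ (‖1 + z‖ ^ μ.re * Real.exp (Real.pi * |μ.im|)) *
        (‖1 + z‖ ^ ν.re * Real.exp (Real.pi * |ν.im|)) * Real.exp ‖t‖ := by gcongr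
    _ = _ := by ring

theorem intervalIntegrable_abs_sub_rpow {s : ℝ} (hs : -1 < s) :
    IntervalIntegrable (fun θ : ℝ => |θ - Real.pi| ^ s) volume 0 (2 * Real.pi) := by
  have h₁ : IntervalIntegrable (fun x : ℝ => |x| ^ s) volume 0 Real.pi := by
    refine (intervalIntegral.intervalIntegrable_rpow' hs).congr fun x hx => ?_
    rw [Set.uIoc_of_le Real.pi_pos.le] at hx
    simp only [abs_of_pos hx.1]
  have h₂ : IntervalIntegrable (fun x : ℝ => |x| ^ s) volume (-Real.pi) 0 := by
    simpa using ((IntervalIntegrable.iff_comp_neg (by simp)).mp h₁).symm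
  have h₃ := (h₂.trans h₁).comp_sub_right Real.pi
  simpa [two_mul] using h₃

theorem measurable_weight_exp (μ ν t : ℂ) :
    Measurable fun θ : ℝ => weight μ ν t (Complex.exp (θ * Complex.I)) := by
  unfold weight
  fun_prop

theorem intervalIntegrable_weight {μ ν : ℂ} (hμν : -1 < (μ + ν).re) (t : ℂ) :
    IntervalIntegrable (fun θ : ℝ => weight μ ν t (Complex.exp (θ * Complex.I))) volume
      0 (2 * Real.pi) := by
  set s := (μ + ν).re with hs
  set A := Real.exp (Real.pi * |μ.im|) * Real.exp (Real.pi * |ν.im|) * Real.exp ‖t‖ with hA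
  have hA0 : 0 < A := by positivity
  have hb : IntervalIntegrable
      (fun θ : ℝ => A * ((2 / Real.pi) ^ s * |θ - Real.pi| ^ s + 2 ^ s)) volume 0 (2 * Real.pi) :=
    (((intervalIntegrable_abs_sub_rpow hμν).const_mul _).add intervalIntegrable_const).const_mul _
  refine hb.mono_fun' (measurable_weight_exp μ ν t).aestronglyMeasurable ?_
  have hne : ∀ᵐ θ : ℝ ∂volume, θ ≠ Real.pi := by
    simp [ae_iff]
  rw [Filter.EventuallyLE, ae_restrict_iff' measurableSet_uIoc]
  filter_upwards [hne] with θ hθ hmem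
  rw [Set.uIoc_of_le (by positivity)] at hmem
  have h0 := one_add_exp_ne_zero hmem.1.le hmem.2 hθ
  refine (norm_weight_exp_le μ ν t h0).trans ?_
  gcongr
  have hx : 0 < |θ - Real.pi| := abs_pos.mpr (sub_ne_zero.mpr hθ)
  -- Near `z = -1` the weight is unbounded only if `s < 0`.
  rcases le_total 0 s with h | h
  · have : ‖1 + Complex.exp (θ * Complex.I)‖ ≤ 2 := by
      rw [norm_one_add_exp]
      have := Real.abs_sin_le_one ((θ - Real.pi) / 2)
      linarith
    calc _ ≤ (2 : ℝ) ^ s := Real.rpow_le_rpow (norm_nonneg _) this h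
      _ ≤ _ := le_add_of_nonneg_left (by positivity)
  · rw [← Real.mul_rpow (by positivity) (by positivity)]
    calc _ ≤ (2 / Real.pi * |θ - Real.pi|) ^ s :=
          Real.rpow_le_rpow_of_nonpos (by positivity) (le_norm_one_add_exp hmem.1.le hmem.2) h
      _ ≤ _ := le_add_of_nonneg_right (by positivity)

theorem fourierCoef_eq (w : ℂ → ℂ) (k : ℤ) :
    fourierCoef w k = (2 * (Real.pi : ℂ))⁻¹ *
      ∫ θ in (0 : ℝ)..2 * Real.pi, w (Complex.exp (θ * Complex.I)) *
        Complex.exp (θ * Complex.I) ^ (-k) := by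
  rw [fourierCoef, circleIntegral]
  have : ∀ θ : ℝ, deriv (circleMap 0 1) θ • (w (circleMap 0 1 θ) * circleMap 0 1 θ ^ (-k) /
      circleMap 0 1 θ) = Complex.I * (w (Complex.exp (θ * Complex.I)) *
        Complex.exp (θ * Complex.I) ^ (-k)) := fun θ => by
    have h0 : Complex.exp (θ * Complex.I) ≠ 0 := Complex.exp_ne_zero _
    simp only [deriv_circleMap, circleMap, smul_eq_mul, Complex.ofReal_one, one_mul, zero_add]
    field_simp
  simp only [this]
  rw [intervalIntegral.integral_const_mul, ← mul_assoc]
  congr 1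
  field_simp

theorem intervalIntegrable_weight_mul_zpow {μ ν : ℂ} (hμν : -1 < (μ + ν).re) (t : ℂ) (k : ℤ) :
    IntervalIntegrable (fun θ : ℝ => weight μ ν t (Complex.exp (θ * Complex.I)) *
      Complex.exp (θ * Complex.I) ^ k) volume 0 (2 * Real.pi) := by
  refine (intervalIntegrable_weight hμν t).mul_continuousOn (Continuous.continuousOn ?_)
  exact Continuous.zpow₀ (by fun_prop) k fun θ => Or.inl (Complex.exp_ne_zero _)

/-- The Pearson equation in the form
`z ((1 + z) w z^{-k})' = (t z² + (μ + t + 1 - k) z - (k + ν)) w z^{-k}`. -/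
theorem hasDerivAt_weight (μ ν t : ℂ) (k : ℤ) {z : ℂ} (hz : z ≠ 0) (h₁ : 1 + z ∈ Complex.slitPlane)
    (h₂ : 1 + z⁻¹ ∈ Complex.slitPlane) :
    HasDerivAt (fun z => (1 + z) * weight μ ν t z * z ^ (-k))
      (z⁻¹ * (t * (weight μ ν t z * z ^ (-(k - 2))) +
        (μ + t + 1 - k) * (weight μ ν t z * z ^ (-(k - 1))) -
        (k + ν) * (weight μ ν t z * z ^ (-k)))) z := by
  have d₁ := ((hasDerivAt_id z).const_add 1).cpow_const (c := μ) h₁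
  have d₂ := ((hasDerivAt_inv hz).const_add 1).cpow_const (c := ν) h₂
  have d₃ := ((hasDerivAt_id z).const_mul t).cexp
  have d₄ := hasDerivAt_zpow (-k) z (Or.inl hz)
  have d := (((hasDerivAt_id z).const_add 1).mul ((d₁.mul d₂).mul d₃)).mul d₄
  have n₁ : 1 + z ≠ 0 := Complex.slitPlane_ne_zero h₁
  have n₂ : 1 + z⁻¹ ≠ 0 := Complex.slitPlane_ne_zero h₂
  have n₃ : z + 1 ≠ 0 := by rwa [add_comm]
  refine d.congr_deriv ?_
  simp only [id, Pi.mul_apply, weight]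
  rw [Complex.cpow_sub _ _ n₁, Complex.cpow_sub _ _ n₂, Complex.cpow_one, Complex.cpow_one,
    show -(k - 2) = -k + 2 by ring, show -(k - 1) = -k + 1 by ring, zpow_add₀ hz, zpow_add₀ hz,
    zpow_sub₀ hz]
  have e : 1 + z⁻¹ = (1 + z) / z := by field_simp; ring
  generalize (1 + z⁻¹) ^ ν = B
  rw [e]
  generalize (1 + z) ^ μ = A
  generalize Complex.exp (t * z) = E
  push_cast
  field_simp
  ring

theorem one_add_mem_slitPlane {z : ℂ} (hz : ‖z‖ = 1) (h : 1 + z ≠ 0) : 1 + z ∈ Complex.slitPlane := by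
  rw [Complex.mem_slitPlane_iff]
  by_cases him : z.im = 0
  · left
    have h1 := Complex.abs_re_le_norm z
    rw [hz, abs_le] at h1
    have h2 : z.re ≠ -1 := fun h2 => h (by apply Complex.ext <;> simp [h2, him])
    have := lt_of_le_of_ne h1.1 h2.symm
    simp
    linarith
  · right
    simpa using him

theorem hasDerivAt_weight_exp (μ ν t : ℂ) (k : ℤ) {θ : ℝ}
    (h : 1 + Complex.exp (θ * Complex.I) ≠ 0) :
    HasDerivAt (fun θ : ℝ => (1 + Complex.exp (θ * Complex.I)) *
        weight μ ν t (Complex.exp (θ * Complex.I)) * Complex.exp (θ * Complex.I) ^ (-k))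
      (Complex.I * (t * (weight μ ν t (Complex.exp (θ * Complex.I)) *
          Complex.exp (θ * Complex.I) ^ (-(k - 2))) +
        (μ + t + 1 - k) * (weight μ ν t (Complex.exp (θ * Complex.I)) *
          Complex.exp (θ * Complex.I) ^ (-(k - 1))) -
        (k + ν) * (weight μ ν t (Complex.exp (θ * Complex.I)) *
          Complex.exp (θ * Complex.I) ^ (-k)))) θ := by
  have hz0 : Complex.exp (θ * Complex.I) ≠ 0 := Complex.exp_ne_zero _
  have hz1 : ‖Complex.exp (θ * Complex.I)‖ = 1 := Complex.norm_exp_ofReal_mul_I θ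
  have hinv : 1 + (Complex.exp (θ * Complex.I))⁻¹ ≠ 0 := by
    intro h0
    apply h
    have := congrArg (Complex.exp (θ * Complex.I) * ·) h0
    simp only [mul_add, mul_inv_cancel₀ hz0, mul_one, mul_zero] at this
    rwa [add_comm]
  have d₁ : HasDerivAt (fun θ : ℝ => Complex.exp (θ * Complex.I))
      (Complex.exp (θ * Complex.I) * Complex.I) θ := by
    have := ((hasDerivAt_id θ).ofReal_comp.mul_const Complex.I).cexp
    simpa using this
  have d := (hasDerivAt_weight μ ν t k hz0 (one_add_mem_slitPlane hz1 h)
    (one_add_mem_slitPlane (by rw [norm_inv, hz1, inv_one]) hinv)).comp θ d₁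
  refine d.congr_deriv ?_
  field_simp

theorem continuous_one_add_mul_weight {μ ν : ℂ} (hμν : -1 < (μ + ν).re) (t : ℂ) (k : ℤ) :
    Continuous (fun θ : ℝ => (1 + Complex.exp (θ * Complex.I)) *
        weight μ ν t (Complex.exp (θ * Complex.I)) * Complex.exp (θ * Complex.I) ^ (-k)) := by
  rw [continuous_iff_continuousAt]
  intro θ
  by_cases h : 1 + Complex.exp (θ * Complex.I) ≠ 0
  · exact (hasDerivAt_weight_exp μ ν t k h).continuousAt
  · rw [not_not] at h
    rw [ContinuousAt, h, zero_mul, zero_mul]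
    have hs : 0 < (μ + ν).re + 1 := by linarith
    have hlim : Filter.Tendsto (fun θ : ℝ => Real.exp (Real.pi * |μ.im|) *
        Real.exp (Real.pi * |ν.im|) * Real.exp ‖t‖ *
          ‖1 + Complex.exp (θ * Complex.I)‖ ^ ((μ + ν).re + 1)) (nhds θ) (nhds 0) := by
      have hc : Continuous (fun θ : ℝ => Real.exp (Real.pi * |μ.im|) *
          Real.exp (Real.pi * |ν.im|) * Real.exp ‖t‖ *
          ‖1 + Complex.exp (θ * Complex.I)‖ ^ ((μ + ν).re + 1)) :=
        continuous_const.mul (Continuous.rpow_const (by fun_prop) fun _ => Or.inr hs.le)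
      have := hc.tendsto θ
      rwa [h, norm_zero, Real.zero_rpow hs.ne', mul_zero] at this
    refine squeeze_zero_norm (fun x => ?_) hlim
    by_cases hx : 1 + Complex.exp (x * Complex.I) = 0
    · rw [hx, zero_mul, zero_mul, norm_zero]
      positivity
    · have h₁ := norm_weight_exp_le μ ν t hx
      rw [norm_mul, norm_mul, norm_zpow, Complex.norm_exp_ofReal_mul_I, one_zpow, mul_one,
        Real.rpow_add (norm_pos_iff.mpr hx), Real.rpow_one]
      refine (mul_le_mul_of_nonneg_left h₁ (norm_nonneg _)).trans_eq ?_
      ring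

/-- The integral over the circle of the derivative of `(1 + z) w(z) z^{-k}` is zero: this function
is continuous on the circle, also at `z = -1`, and differentiable off that point. -/
theorem fourierCoef_recurrence {μ ν : ℂ} (hμν : -1 < (μ + ν).re) (t : ℂ) (k : ℤ) :
    (k + ν) * fourierCoef (weight μ ν t) k =
      (μ + t - k + 1) * fourierCoef (weight μ ν t) (k - 1) +
        t * fourierCoef (weight μ ν t) (k - 2) := by
  have i₀ := intervalIntegrable_weight_mul_zpow hμν t (-k)
  have i₁ := intervalIntegrable_weight_mul_zpow hμν t (-(k - 1))
  have i₂ := intervalIntegrable_weight_mul_zpow hμν t (-(k - 2))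
  have h := integral_eq_of_hasDerivAt_off_countable_of_le _ _ (by positivity : 0 ≤ 2 * Real.pi)
    (Set.countable_singleton Real.pi) (continuous_one_add_mul_weight hμν t k).continuousOn
    (fun θ hθ => hasDerivAt_weight_exp μ ν t k
      (one_add_exp_ne_zero hθ.1.1.le hθ.1.2.le hθ.2))
    ((((i₂.const_mul t).add (i₁.const_mul (μ + t + 1 - k))).sub (i₀.const_mul (k + ν))).const_mul
      Complex.I)
  rw [intervalIntegral.integral_const_mul, intervalIntegral.integral_sub
    ((i₂.const_mul t).add (i₁.const_mul (μ + t + 1 - k))) (i₀.const_mul (k + ν)),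
    intervalIntegral.integral_add (i₂.const_mul t) (i₁.const_mul (μ + t + 1 - k)),
    intervalIntegral.integral_const_mul, intervalIntegral.integral_const_mul,
    intervalIntegral.integral_const_mul] at h
  push_cast at h
  rw [Complex.exp_two_pi_mul_I, zero_mul, Complex.exp_zero, sub_self, mul_eq_zero] at h
  have h' := h.resolve_left Complex.I_ne_zero
  rw [fourierCoef_eq, fourierCoef_eq, fourierCoef_eq]
  linear_combination (-(2 * (Real.pi : ℂ))⁻¹) * h'

theorem weight_eq (μ ν t z : ℂ) : weight μ ν t z = weight μ ν 0 z * Complex.exp (t * z) := by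
  simp [weight]

/-- The weight satisfies `∂w/∂t = z w`. -/
theorem hasDerivAt_fourierCoef {μ ν : ℂ} (hμν : -1 < (μ + ν).re) (t : ℂ) (k : ℤ) :
    HasDerivAt (fun s => fourierCoef (weight μ ν s) k) (fourierCoef (weight μ ν t) (k - 1)) t := by
  simp only [fourierCoef_eq]
  refine HasDerivAt.const_mul _ ?_
  have hb : IntervalIntegrable (fun θ : ℝ => ‖weight μ ν 0 (Complex.exp (θ * Complex.I))‖ *
      Real.exp (‖t‖ + 1)) volume 0 (2 * Real.pi) :=
    (intervalIntegrable_weight hμν 0).norm.mul_const _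
  refine (intervalIntegral.hasDerivAt_integral_of_dominated_loc_of_deriv_le
    (Metric.ball_mem_nhds t one_pos) (Filter.Eventually.of_forall fun s =>
      (intervalIntegrable_weight_mul_zpow hμν s (-k)).def'.aestronglyMeasurable)
    (intervalIntegrable_weight_mul_zpow hμν t (-k))
    (F' := fun s θ => weight μ ν s (Complex.exp (θ * Complex.I)) *
      Complex.exp (θ * Complex.I) ^ (-(k - 1)))
    (intervalIntegrable_weight_mul_zpow hμν t (-(k - 1))).def'.aestronglyMeasurable
    (Filter.Eventually.of_forall fun θ _ s hs => ?_) hb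
    (Filter.Eventually.of_forall fun θ _ s _ => ?_)).2
  · rw [weight_eq, norm_mul, norm_mul, norm_zpow, Complex.norm_exp_ofReal_mul_I, one_zpow, mul_one]
    gcongr
    refine (Complex.norm_exp_le_exp_norm _).trans ?_
    rw [norm_mul, Complex.norm_exp_ofReal_mul_I, mul_one]
    gcongr
    have := norm_sub_norm_le s t
    rw [Metric.mem_ball, dist_eq_norm] at hs
    linarith
  · have hz : Complex.exp (θ * Complex.I) ≠ 0 := Complex.exp_ne_zero _
    have d := ((((hasDerivAt_id s).mul_const (Complex.exp (θ * Complex.I))).cexp.const_mul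
      (weight μ ν 0 (Complex.exp (θ * Complex.I)))).mul_const (Complex.exp (θ * Complex.I) ^ (-k)))
    have hf : (fun x => weight μ ν x (Complex.exp (θ * Complex.I)) *
        Complex.exp (θ * Complex.I) ^ (-k)) = fun x => weight μ ν 0 (Complex.exp (θ * Complex.I)) *
          Complex.exp (x * Complex.exp (θ * Complex.I)) * Complex.exp (θ * Complex.I) ^ (-k) :=
      funext fun x => by rw [weight_eq μ ν x]
    rw [hf, weight_eq μ ν s]
    refine d.congr_deriv ?_
    rw [show -(k - 1) = -k + 1 by ring, zpow_add₀ hz, zpow_one]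
    simp only [id]
    ring

/-- Expanding `e^{tz}` under the integral sign. -/
theorem hasSum_fourierCoef {μ ν : ℂ} (hμν : -1 < (μ + ν).re) (t : ℂ) :
    HasSum (fun j : ℕ => t ^ j / (j.factorial : ℂ) * fourierCoef (weight μ ν 0) (-j))
      (fourierCoef (weight μ ν t) 0) := by
  have h := intervalIntegral.hasSum_integral_of_dominated_convergence (μ := volume)
    (a := 0) (b := 2 * Real.pi)
    (F := fun (j : ℕ) (θ : ℝ) => t ^ j / (j.factorial : ℂ) *
      (weight μ ν 0 (Complex.exp (θ * Complex.I)) * Complex.exp (θ * Complex.I) ^ (-(-(j : ℤ)))))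
    (f := fun θ : ℝ => weight μ ν t (Complex.exp (θ * Complex.I)) *
      Complex.exp (θ * Complex.I) ^ (-(0 : ℤ)))
    (fun j θ => ‖t‖ ^ j / (j.factorial : ℝ) * ‖weight μ ν 0 (Complex.exp (θ * Complex.I))‖)
    (fun j => ((intervalIntegrable_weight_mul_zpow hμν 0 _).const_mul _).def'.aestronglyMeasurable)
    (fun j => Filter.Eventually.of_forall fun θ _ => by
      rw [norm_mul, norm_mul, norm_zpow, Complex.norm_exp_ofReal_mul_I, one_zpow, mul_one, norm_div,
        norm_pow, Complex.norm_natCast])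
    (Filter.Eventually.of_forall fun θ _ =>
      (Real.summable_pow_div_factorial ‖t‖).mul_right _)
    (by
      simp only [tsum_mul_right]
      exact (intervalIntegrable_weight hμν 0).norm.const_mul _)
    (Filter.Eventually.of_forall fun θ _ => by
      have e := (NormedSpace.expSeries_div_hasSum_exp (𝔸 := ℂ)
        (t * Complex.exp (θ * Complex.I))).mul_left (weight μ ν 0 (Complex.exp (θ * Complex.I)))
      rw [← Complex.exp_eq_exp_ℂ, ← weight_eq] at e
      rw [neg_zero, zpow_zero, mul_one]
      refine e.congr_fun fun j => ?_
      rw [neg_neg, zpow_natCast, mul_pow]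
      ring)
  have h' := h.mul_left (2 * (Real.pi : ℂ))⁻¹
  rw [← fourierCoef_eq] at h'
  refine h'.congr_fun fun j => ?_
  rw [intervalIntegral.integral_const_mul, fourierCoef_eq]
  ring

theorem fourierCoef_neg {μ ν : ℂ} (hμν : -1 < (μ + ν).re) (hμ : ∀ k : ℕ, μ + 1 ≠ -(k : ℂ)) (j : ℕ) :
    fourierCoef (weight μ ν 0) (-j) = (-1) ^ j * ((ascPochhammer ℂ j).eval (-ν) /
      (ascPochhammer ℂ j).eval (μ + 1)) * fourierCoef (weight μ ν 0) 0 := by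
  induction j with
  | zero => simp
  | succ j ih =>
    have h := fourierCoef_recurrence hμν 0 (-j)
    have hne : μ + 1 + j ≠ 0 := fun h0 => hμ j (by linear_combination h0)
    rw [ascPochhammer_succ_eval, ascPochhammer_succ_eval, mul_div_mul_comm]
    rw [show (-((j : ℤ)) - 1) = -((j + 1 : ℕ) : ℤ) by push_cast; ring, ih] at h
    push_cast at h ⊢
    rw [← mul_right_inj' hne]
    have hq : (μ + 1 + j) * ((-ν + j) / (μ + 1 + j)) = -ν + j := mul_div_cancel₀ _ hne
    linear_combination -h + (-1) ^ j * ((ascPochhammer ℂ j).eval (-ν) /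
      (ascPochhammer ℂ j).eval (μ + 1)) * fourierCoef (weight μ ν 0) 0 * hq

theorem fourierCoef_zero_eq {μ ν : ℂ} (hμν : -1 < (μ + ν).re) (hμ : ∀ k : ℕ, μ + 1 ≠ -(k : ℂ))
    (t : ℂ) : fourierCoef (weight μ ν t) 0 =
      fourierCoef (weight μ ν 0) 0 * kummer (-ν) (μ + 1) (-t) := by
  rw [← (hasSum_fourierCoef hμν t).tsum_eq, kummer, ← tsum_mul_left]
  congr 1
  ext j
  rw [fourierCoef_neg hμν hμ, neg_pow t]
  ring

/-- The seed value `p₀` is `t w₋₁ / w₀ = -t r₁`: Kummer's function is a constant multiple of `w₀`. -/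
theorem seed_p {μ ν t : ℂ} (hμν : -1 < (μ + ν).re) (hμ : ∀ k : ℕ, μ + 1 ≠ -(k : ℂ))
    (h0 : fourierCoef (weight μ ν t) 0 ≠ 0) :
    (seed μ ν t).p =
      t * (fourierCoef (weight μ ν t) (-1) / fourierCoef (weight μ ν t) 0) := by
  have hc : fourierCoef (weight μ ν 0) 0 ≠ 0 := fun h => h0 (by
    rw [fourierCoef_zero_eq hμν hμ, h, zero_mul])
  have hfun : (fun s => kummer (-ν) (μ + 1) (-s)) = fun s =>
      (fourierCoef (weight μ ν 0) 0)⁻¹ * fourierCoef (weight μ ν s) 0 := by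
    ext s
    rw [fourierCoef_zero_eq hμν hμ s, inv_mul_cancel_left₀ hc]
  have hd := ((hasDerivAt_fourierCoef hμν t 0).const_mul (fourierCoef (weight μ ν 0) 0)⁻¹).deriv
  rw [zero_sub] at hd
  simp only [seed, logDeriv_apply, hfun, hd]
  field_simp

/-- For `ν = 0` Kummer's function is constant, hence so is `w₀` as a function of `t`. -/
theorem fourierCoef_neg_one_eq_zero {μ ν : ℂ} (hμν : -1 < (μ + ν).re)
    (hμ : ∀ k : ℕ, μ + 1 ≠ -(k : ℂ)) (hν : ν = 0) (t : ℂ) :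
    fourierCoef (weight μ ν t) (-1) = 0 := by
  have hfun : (fun s => fourierCoef (weight μ ν s) 0) = fun _ =>
      fourierCoef (weight μ ν 0) 0 := by
    ext s
    rw [fourierCoef_zero_eq hμν hμ s, kummer, tsum_eq_single 0]
    · simp
    · intro j hj
      obtain ⟨j, rfl⟩ := Nat.exists_eq_succ_of_ne_zero hj
      simp [hν]
  have hd := (hasDerivAt_fourierCoef hμν t 0)
  rw [hfun, zero_sub] at hd
  exact hd.unique (hasDerivAt_const t _)

/-! ### Iterating the Schlesinger transformation -/

/-- The Hamiltonian variables in terms of the reflection coefficients and of the values `a n`, `b n`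
at `z = -1` of the polynomials in the Szegő recursion. Each regular step supplies the
nonvanishing of the next pair of values. -/
theorem state_eq (μ ν t : ℂ) (r rbar a b : ℕ → ℂ) (N : ℕ)
    (ha0 : a 0 = 1) (hb0 : b 0 = 1) (hrbar0 : rbar 0 = 1)
    (ha : ∀ n < N, a (n + 1) = -a n + r (n + 1) * b n)
    (hb : ∀ n < N, b (n + 1) = b n - rbar (n + 1) * a n)
    (hA : ∀ n ≤ N, (ν + t * r (n + 1) * rbar n) * a n = (t * r (n + 1) + (n + ν) * r n) * b n)
    (hB : ∀ n < N, (μ - t * r (n + 1) * rbar n) * b n =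
      -((n + 1 + ν) * rbar (n + 1) + t * rbar n) * a n)
    (hk : ∀ n < N, 1 - r (n + 1) * rbar (n + 1) ≠ 0)
    (hp : (seed μ ν t).p = -t * r 1)
    (hreg : ∀ n < N, (state μ ν t n).Regular t) :
    ∀ n ≤ N, a n ≠ 0 ∧ b n ≠ 0 ∧ (n ≠ 0 → n + ν ≠ 0) ∧
      state μ ν t n = ⟨1 + μ + ν + n, -μ, -ν, -n, rbar n * a n / b n, -t * r (n + 1) * b n / a n⟩ := by
  intro n
  induction n with
  | zero =>
    intro _
    refine ⟨by simp [ha0], by simp [hb0], by simp, ?_⟩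
    ext
    all_goals simp [state, ha0, hb0, hrbar0, ← hp]
    all_goals simp [seed]
  | succ n ih =>
    intro hn
    have hnN : n < N := hn
    obtain ⟨han, hbn, -, hS⟩ := ih hnN.le
    obtain ⟨h₀, h₁, h₂⟩ := hreg n hnN
    have hstep : state μ ν t (n + 1) = (state μ ν t n).schlesinger t := by
      rw [state, Function.iterate_succ_apply', ← state]
    have ha' := ha n hnN
    have hb' := hb n hnN
    have hB' := hB n hnN
    have hA' := hA (n + 1) hn
    have hk' := hk n hnN
    have hpt : (state μ ν t n).p + t = -t * a (n + 1) / a n := by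
      rw [hS, ha']
      field_simp
      ring
    have han' : a (n + 1) ≠ 0 := by
      intro h0
      rw [hpt, h0] at h₀
      simp at h₀
    have ht : t ≠ 0 := by
      rintro rfl
      rw [hpt] at h₀
      simp at h₀
    -- The numerator of `q'` simplifies by the second relation at `z = -1`.
    have hq' : ((state μ ν t n).s₀ t).q = -(n + 1 + ν) * a n * b (n + 1) / (t * b n * a (n + 1)) := by
      rw [State.s₀, hpt, hS]
      field_simp
      linear_combination (t * rbar n) * ha' - hB' + (n + 1 + ν) * hb'
    have hbn' : b (n + 1) ≠ 0 := by
      intro h0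
      rw [hq', h0] at h₁
      simp at h₁
    have hν : (n : ℂ) + 1 + ν ≠ 0 := by
      intro h0
      rw [hq', h0] at h₁
      simp at h₁
    have hα : (state μ ν t n).α₀ + (state μ ν t n).α₁ = n + 1 + ν := by
      rw [hS]
      ring
    have hp' : ((state μ ν t n).s₀ t).s₁.p =
        -t * b n * (1 - r (n + 1) * rbar (n + 1)) / b (n + 1) := by
      have : ((state μ ν t n).s₀ t).s₁.p = (state μ ν t n).p -
          ((state μ ν t n).α₀ + (state μ ν t n).α₁) / ((state μ ν t n).s₀ t).q := by
        rw [add_comm]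
        rfl
      rw [this, hα, hq', hS]
      field_simp
      linear_combination ha' - r (n + 1) * hb'
    refine ⟨han', hbn', fun _ => by push_cast; exact hν, ?_⟩
    have hq'' : ((state μ ν t n).s₀ t).s₁.s₂.q = r (n + 2) * b (n + 1) / a (n + 1) := by
      have : ((state μ ν t n).s₀ t).s₁.s₂.q = ((state μ ν t n).s₀ t).q +
          ((state μ ν t n).α₂ + ((state μ ν t n).α₁ + (state μ ν t n).α₀))
            / ((state μ ν t n).s₀ t).s₁.p := rfl
      rw [this, hq', hp', hS]
      push_cast at hA'
      field_simp
      linear_combination hA' - (n + 1 + ν) * (ha' - r (n + 1) * hb') +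
        t * r (n + 2) * (hb' - rbar (n + 1) * ha')
    rw [hstep]
    ext
    · simp [State.schlesinger, State.rot, State.s₂, State.s₁, State.s₀, hS]
      ring
    · simp [State.schlesinger, State.rot, State.s₂, State.s₁, State.s₀, hS]
      ring
    · simp [State.schlesinger, State.rot, State.s₂, State.s₁, State.s₀, hS]
      ring
    · simp [State.schlesinger, State.rot, State.s₂, State.s₁, State.s₀, hS]
      ring
    · have : ((state μ ν t n).schlesinger t).q = (((state μ ν t n).s₀ t).s₁.p + t) / t := rfl
      rw [this, hp']
      field_simp
      linear_combination hb' - rbar (n + 1) * ha'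
    · have : ((state μ ν t n).schlesinger t).p = -t * ((state μ ν t n).s₀ t).s₁.s₂.q := rfl
      rw [this, hq'']
      ring

/-- The consequences of `q = r̄ a / b`, `p = -t r₁ b / a` and the first relation between the values
`a`, `b` at a single index `n`; here `r₀`, `r₁`, `rb` stand for `r n`, `r (n+1)`, `r̄ n`. -/
theorem relations_of_state (μ ν t : ℂ) (n r₁ r₀ rb a b x y : ℂ)
    (ha : a ≠ 0) (hb : b ≠ 0) (hr : r₀ ≠ 0) (hrb : rb ≠ 0) (hn : n + ν ≠ 0)
    (hD : t * r₁ + (n + ν) * r₀ ≠ 0)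
    (hA : (ν + t * r₁ * rb) * a = (t * r₁ + (n + ν) * r₀) * b)
    (hy : y = 1 / (rb * a / b)) (hx : x = (-t * r₁ * b / a + t) * (rb * a / b) + μ / 2) :
    (x - t / y - μ / 2) * (1 - y) - ν ≠ 0 ∧
    (1 / y - 1) * (x - t / y - ν - μ / 2) + n = (n + ν) * (1 - r₀ * rb) ∧
    (x - t / y - ν - μ / 2) * (1 + (n + ν) / ((x - t / y - μ / 2) * (1 - y) - ν)) - n
      = t * (r₁ / r₀) * (1 - r₀ * rb) ∧
    y = (ν + t * r₁ * rb) / (rb * (t * r₁ + (n + ν) * r₀)) ∧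
    x - t / y - μ / 2 = -t * r₁ * rb := by
  have hs : ν + t * r₁ * rb ≠ 0 := fun h => mul_ne_zero hD hb (by rw [← hA, h, zero_mul])
  have hy' : y = (ν + t * r₁ * rb) / (rb * (t * r₁ + (n + ν) * r₀)) := by
    rw [hy]
    field_simp
    linear_combination -hA
  have hx' : x - t / y - μ / 2 = -t * r₁ * rb := by
    rw [hx, hy]
    field_simp
    ring
  have hx'' : x - t / y - ν - μ / 2 = -(ν + t * r₁ * rb) := by linear_combination hx'
  have hden : (x - t / y - μ / 2) * (1 - y) - ν =
      -((n + ν) * r₀ * (ν + t * r₁ * rb)) / (t * r₁ + (n + ν) * r₀) := by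
    rw [hx', hy']
    field_simp
    ring
  refine ⟨?_, ?_, ?_, hy', hx'⟩
  · rw [hden]
    exact div_ne_zero (neg_ne_zero.mpr (mul_ne_zero (mul_ne_zero hn hr) hs)) hD
  · rw [hx'', hy']
    field_simp
    ring
  · rw [hx'', hden]
    field_simp
    ring

/-- The relation for `r̄ (n-1) / r̄ n`. The primes mark the quantities at index `n - 1`, and `hB` is the
second relation between the values at `z = -1`, taken at that index. -/
theorem reflBar_relation (μ ν t : ℂ) (n r₁ r₀ rb rb' a b a' b' x y : ℂ)
    (ha : a ≠ 0) (hrb : rb ≠ 0)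
    (ha' : a = -a' + r₀ * b') (hb' : b = b' - rb * a')
    (hA : (ν + t * r₁ * rb) * a = (t * r₁ + (n + ν) * r₀) * b)
    (hB : (μ - t * r₀ * rb') * b' = -((n + ν) * rb + t * rb') * a')
    (hy : y = 1 / (rb * a / b)) (hx : x - t / y - μ / 2 = -t * r₁ * rb) :
    (1 - y) * (x - t / y + μ / 2) + n = -t * (rb' / rb) * (1 - r₀ * rb) := by
  have hx' : x - t / y + μ / 2 = μ - t * r₁ * rb := by linear_combination hx
  rw [hx', hy]
  field_simp
  linear_combination (-rb) * hA + (n + ν) * rb * (ha' - r₀ * hb') + μ * (rb * ha' - hb') +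
    (1 - r₀ * rb) * (t * rb' * ha' - hB)

/-! ### The recursion at the zero of `1 + z` -/

/-- The values at `z = -1` of the polynomials of the Szegő recursion. -/
theorem exists_values_at_neg_one {c : ℤ → ℂ} {μ ν t : ℂ}
    (hc : ∀ k : ℤ, (k + ν) * c k = (μ + t - k + 1) * c (k - 1) + t * c (k - 2))
    {r s : ℕ → ℂ} (hr : ∀ n, r n = (-1) ^ n * (toepDet c 1 n / toepDet c 0 n))
    (hs : ∀ n, s n = (-1) ^ n * (toepDet c (-1) n / toepDet c 0 n))
    {N : ℕ} (hN : ∀ n ≤ N + 1, toepDet c 0 n ≠ 0) :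
    ∃ a b : ℕ → ℂ, a 0 = 1 ∧ b 0 = 1 ∧
      (∀ n, a (n + 1) = -a n + r (n + 1) * b n) ∧
      (∀ n, b (n + 1) = b n - s (n + 1) * a n) ∧
      (∀ n ≤ N, (ν + t * r (n + 1) * s n) * a n = (t * r (n + 1) + (n + ν) * r n) * b n) ∧
      (∀ n ≤ N, (μ - t * r (n + 1) * s n) * b n =
        -((n + 1 + ν) * s (n + 1) + t * s n) * a n) := by
  refine ⟨fun n => (szegoPoly r s n).1.eval (-1), fun n => (szegoPoly r s n).2.eval (-1),
    by simp [szegoPoly], by simp [szegoPoly], fun n => ?_, fun n => ?_, fun n hn => ?_,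
    fun n hn => ?_⟩
  · simp [szegoPoly]
  · simp [szegoPoly, sub_eq_add_neg]
  · obtain ⟨h, P⟩ := exists_isSzegoPair hr hs hN n (by omega)
    obtain ⟨h₁, -⟩ := moment_eq_of_isSzegoPair hr hs P (hN _ (by omega))
    have hd := congrArg (eval (-1)) (P.derivative_a hc (hN _ (by omega)) h₁)
    rw [P.coeff_zero (hN _ (by omega)), ← hr, P.coeff_self (hN _ (by omega)), ← hs] at hd
    simp only [eval_add, eval_sub, eval_mul, eval_X, eval_C] at hd
    linear_combination -hd
  · obtain ⟨h, P⟩ := exists_isSzegoPair hr hs hN n (by omega)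
    obtain ⟨h₁, h₂⟩ := moment_eq_of_isSzegoPair hr hs P (hN _ (by omega))
    have hd := congrArg (eval (-1)) (P.derivative_b hc (hN _ (by omega)) h₁ h₂)
    rw [P.coeff_self (hN _ (by omega)), ← hs] at hd
    simp only [eval_add, eval_sub, eval_mul, eval_X, eval_C] at hd
    linear_combination hd

end PainleveV

theorem mainTheorem6 (μ ν t : ℂ)
    (hμν : -1 < (μ + ν).re)
    (hμ : ∀ k : ℕ, μ + 1 ≠ -(k : ℂ))
    (N : ℕ)
    (hI : ∀ n ≤ N + 1, PainleveV.toeplitzDet (PainleveV.weight μ ν t) 0 n ≠ 0)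
    (hr : ∀ n ≤ N, PainleveV.refl μ ν t n ≠ 0)
    (hrbar : ∀ n ≤ N, PainleveV.reflBar μ ν t n ≠ 0)
    (hden : ∀ n ≤ N, t * PainleveV.refl μ ν t (n + 1) + (n + ν) * PainleveV.refl μ ν t n ≠ 0)
    (hreg : ∀ n < N, (PainleveV.state μ ν t n).Regular t) :
    let r := PainleveV.refl μ ν t
    let rbar := PainleveV.reflBar μ ν t
    let x := PainleveV.xVar μ ν t N
    let y := PainleveV.yVar μ ν t N
    -- the quotients defining `y` and occurring in the second relation are genuine
    PainleveV.qVar μ ν t N ≠ 0 ∧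
    (x - t / y - μ / 2) * (1 - y) - ν ≠ 0 ∧
    -- the three relations
    (1 / y - 1) * (x - t / y - ν - μ / 2) + N = (N + ν) * (1 - r N * rbar N) ∧
    (x - t / y - ν - μ / 2) * (1 + (N + ν) / ((x - t / y - μ / 2) * (1 - y) - ν)) - N
      = t * (r (N + 1) / r N) * (1 - r N * rbar N) ∧
    (1 ≤ N → (1 - y) * (x - t / y + μ / 2) + N
      = -t * (rbar (N - 1) / rbar N) * (1 - r N * rbar N)) ∧
    -- the resulting formulas
    y = (ν + t * r (N + 1) * rbar N) / (rbar N * (t * r (N + 1) + (N + ν) * r N)) ∧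
    x - t / y - μ / 2 = -t * r (N + 1) * rbar N := by
  intro r rbar x y
  set c := PainleveV.fourierCoef (PainleveV.weight μ ν t) with hcdef
  have hr' : ∀ n, r n = (-1) ^ n * (PainleveV.toepDet c 1 n / PainleveV.toepDet c 0 n) :=
    fun _ => rfl
  have hrbar' : ∀ n, rbar n = (-1) ^ n * (PainleveV.toepDet c (-1) n / PainleveV.toepDet c 0 n) :=
    fun _ => rfl
  have hI' : ∀ n ≤ N + 1, PainleveV.toepDet c 0 n ≠ 0 := hI
  have hc0 : c 0 ≠ 0 := by
    have := hI' 1 (by omega)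
    rwa [PainleveV.toepDet_one, neg_zero] at this
  have hr0 : r 0 = 1 := by simp [hr', PainleveV.toepDet_zero]
  have hrbar0 : rbar 0 = 1 := by simp [hrbar', PainleveV.toepDet_zero]
  have hr1 : r 1 = -(c (-1) / c 0) := by
    simp [hr', PainleveV.toepDet_one]
  obtain ⟨a, b, ha0, hb0, ha, hb, hA, hB⟩ := PainleveV.exists_values_at_neg_one
    (PainleveV.fourierCoef_recurrence hμν t) hr' hrbar' hI'
  have hp : (PainleveV.seed μ ν t).p = -t * r 1 := by
    rw [PainleveV.seed_p hμν hμ hc0, hr1]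
    ring
  obtain ⟨haN, hbN, hνN, hS⟩ := PainleveV.state_eq μ ν t r rbar a b N ha0 hb0 hrbar0
    (fun n _ => ha n) (fun n _ => hb n) hA (fun n hn => hB n hn.le)
    (fun n hn => PainleveV.one_sub_mul_ne_zero hr' hrbar' hI' hn) hp hreg N le_rfl
  -- For `N = 0` and `ν = 0` the coefficient `w₋₁` vanishes, and with it `t r₁ + ν r₀`.
  have hν : (N : ℂ) + ν ≠ 0 := by
    rcases eq_or_ne N 0 with rfl | hN
    · rw [Nat.cast_zero, zero_add]
      intro hν0
      apply hden 0 le_rfl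
      have h1 := PainleveV.fourierCoef_neg_one_eq_zero hμν hμ hν0 t
      change t * r 1 + _ = 0
      rw [hr1, hcdef, h1, hν0]
      simp
    · exact hνN hN
  have hq : PainleveV.qVar μ ν t N = rbar N * a N / b N := by rw [PainleveV.qVar, hS]
  have hpN : PainleveV.pVar μ ν t N = -t * r (N + 1) * b N / a N := by rw [PainleveV.pVar, hS]
  have hy : y = 1 / (rbar N * a N / b N) := by rw [← hq]; rfl
  have hx : x = (-t * r (N + 1) * b N / a N + t) * (rbar N * a N / b N) + μ / 2 := by
    rw [← hq, ← hpN]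
    rfl
  obtain ⟨h₁, h₂, h₃, h₄, h₅⟩ := PainleveV.relations_of_state μ ν t N (r (N + 1)) (r N) (rbar N)
    (a N) (b N) x y haN hbN (hr N le_rfl) (hrbar N le_rfl) hν (hden N le_rfl) (hA N le_rfl) hy hx
  refine ⟨?_, h₁, h₂, h₃, fun hN => ?_, h₄, h₅⟩
  · rw [hq]
    exact div_ne_zero (mul_ne_zero (hrbar N le_rfl) haN) hbN
  · obtain ⟨M, rfl⟩ := Nat.exists_eq_add_of_le' hN
    have hBM := hB M (by omega)
    have hAM := hA (M + 1) le_rfl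
    refine PainleveV.reflBar_relation μ ν t _ (r (M + 1 + 1)) (r (M + 1)) (rbar (M + 1)) (rbar M)
      (a (M + 1)) (b (M + 1)) (a M) (b M) x y haN (hrbar _ le_rfl) (ha M) (hb M) hAM ?_ hy h₅
    push_cast
    exact hBM
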